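/- Let $n\ge 1$. A symmetric matrix $B=(b_{ij})\in M_n(\mathbb Z)$ is called tracelike if $b_{11}=n$ and $b_{ii}\equiv b_{1i}^2\pmod 2$ for all $i=2,\dots,n$. For a symmetric matrix $B\in M_n(\mathbb Z)$ define its discriminant pfaffian by \[ \operatorname{dpf}(B)=\sum_{\substack{J\subseteq\{2,\dots,n\}\\ \#J\text{ even}}}\ \sum_{\substack{P\text{ perfect}\\ \text{matching on }J}}\Bigl(\prod_{\{i,j\}\in P} b_{ij}\Bigr)\Bigl(\prod_{k\in\{2,\dots,n\}\smallsetminus J} b_{1k}\Bigr), \] where a perfect matching on $J$ is a partition of $J$ into subsets of cardinality $2$ and empty products are $1$. **Theorem.** (a) If $B\in M_n(\mathbb Z)$ is tracelike, then $\det(B)\equiv \operatorname{dpf}(B)^2\pmod 4$. (b) Let $A$ be a (not necessarily commutative) ring with $1$ that is a free $\mathbb Z$-module of rank $n$, and let $\beta=(e_1,\dots,e_n)$ be a $\mathbb Z$-basis of $A$ with $e_1=1$. For a $\mathbb Z$-basis $\gamma=(f_1,\dots,f_n)$ of $A$ let $B(A,\gamma)$ be the $n\times n$ matrix whose $(i,j)$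 entry is the trace of left multiplication by $f_if_j$ on $A$. Let $\operatorname{disc}(A)=\det B(A,\gamma)$, which does not depend on $\gamma$, and let $\operatorname{dpf}(A,\beta)=\operatorname{dpf}(B(A,\beta))$. Then $\operatorname{disc}(A)\equiv\operatorname{dpf}(A,\beta)^2\pmod 4$. -/

import Mathlib

/-- A symmetric matrix `B ∈ M_n(ℤ)`, `n ≥ 1`, is tracelike if `b₁₁ = n` and `bᵢᵢ ≡ b₁ᵢ² (mod 2)` for
all `i ≠ 1`. Rows and columns are indexed by `Fin n`, so that the first index is `0`. -/
structure IsTracelike {n : ℕ} [NeZero n] (B : Matrix (Fin n) (Fin n) ℤ) : Prop where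
  isSymm : B.IsSymm
  corner : B 0 0 = n
  diag : ∀ i : Fin n, i ≠ 0 → B i i ≡ B 0 i ^ 2 [ZMOD 2]

/-- The entry `b_{ij}` attached to a two-element set `{i, j}`: row the least element, column the
greatest. For symmetric `B` the order of the two elements does not matter, see `pairEntry_pair`. -/
noncomputable def pairEntry {n : ℕ} [NeZero n] (B : Matrix (Fin n) (Fin n) ℤ) (s : Finset (Fin n)) : ℤ :=
  B (s.inf id) (s.sup id)

theorem pairEntry_pair {n : ℕ} [NeZero n] {B : Matrix (Fin n) (Fin n) ℤ} (hB : B.IsSymm)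
    (i j : Fin n) : pairEntry B {i, j} = B i j := by
  rcases le_total i j with h | h
  · simp [pairEntry, h]
  · simp [pairEntry, h, hB.apply]

/-- The perfect matchings on `J`: the partitions of `J` into subsets of cardinality `2`. -/
def perfectMatchings {n : ℕ} (J : Finset (Fin n)) : Finset (Finpartition J) :=
  Finset.univ.filter fun P => ∀ s ∈ P.parts, s.card = 2

/-- The discriminant pfaffian of a matrix. The indices `2, …, n` of the usual notation are the
elements of `Finset.univ.erase 0`. -/
noncomputable def dpf {n : ℕ} [NeZero n] (B : Matrix (Fin n) (Fin n) ℤ) : ℤ :=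
  ∑ J ∈ ((Finset.univ : Finset (Fin n)).erase 0).powerset.filter (fun J => Even J.card),
    ∑ P ∈ perfectMatchings J,
      (∏ s ∈ P.parts, pairEntry B s) *
        ∏ k ∈ (Finset.univ : Finset (Fin n)).erase 0 \ J, B 0 k

/-- The Gram matrix of a (not necessarily commutative) ring `A` in a `ℤ`-basis `β = (e₁, …, eₙ)`: its
entries are the traces of left multiplication by `eᵢ eⱼ`. -/
noncomputable def gramMatrix {A : Type*} [Ring A] {n : ℕ} (β : Module.Basis (Fin n) ℤ A) :
    Matrix (Fin n) (Fin n) ℤ :=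
  Matrix.of fun i j => (Algebra.leftMulMatrix β (β i * β j)).trace

theorem gramMatrix_isSymm {A : Type*} [Ring A] {n : ℕ} (β : Module.Basis (Fin n) ℤ A) :
    (gramMatrix β).IsSymm := by
  ext i j
  simp only [gramMatrix, Matrix.transpose_apply, Matrix.of_apply, map_mul]
  exact Matrix.trace_mul_comm _ _

/-- The discriminant of a ring `A` that is free of finite rank over `ℤ`: the determinant of its Gram
matrix in a `ℤ`-basis. It does not depend on the basis, see `disc_eq_det_gramMatrix`. -/
noncomputable def disc (A : Type*) [Ring A] [Module.Free ℤ A] [Module.Finite ℤ A] : ℤ :=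
  (gramMatrix (Module.finBasis ℤ A)).det

/-- The discriminant pfaffian of a ring `A` with a `ℤ`-basis `β`. -/
noncomputable def ringDpf {A : Type*} [Ring A] {n : ℕ} [NeZero n]
    (β : Module.Basis (Fin n) ℤ A) : ℤ :=
  dpf (gramMatrix β)

theorem disc_eq_det_gramMatrix {A : Type*} [Ring A] [Module.Free ℤ A] [Module.Finite ℤ A] {n : ℕ}
    (β : Module.Basis (Fin n) ℤ A) : disc A = (gramMatrix β).det := by
  have hn : Module.finrank ℤ A = n := by
    simpa using Module.finrank_eq_card_basis β
  subst hn
  set γ := Module.finBasis ℤ A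
  have key : ∀ δ : Module.Basis (Fin (Module.finrank ℤ A)) ℤ A, gramMatrix δ =
      LinearMap.BilinForm.toMatrix δ ((LinearMap.mul ℤ A).compr₂ (LinearMap.trace ℤ A ∘ₗ (Algebra.lmul ℤ A).toLinearMap)) := by
    intro δ
    ext i j
    simp only [gramMatrix, Matrix.of_apply, LinearMap.BilinForm.toMatrix_apply,
      LinearMap.compr₂_apply, LinearMap.mul_apply', LinearMap.comp_apply]
    rw [LinearMap.trace_eq_matrix_trace ℤ δ]
    rfl
  have h := LinearMap.BilinForm.toMatrix_mul_basis_toMatrix (b := β) γ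
    ((LinearMap.mul ℤ A).compr₂ (LinearMap.trace ℤ A ∘ₗ (Algebra.lmul ℤ A).toLinearMap))
  rw [disc, key, key, ← h, Matrix.det_mul, Matrix.det_mul, Matrix.det_transpose]
  have hu : IsUnit (β.toMatrix γ).det := by
    have := congrArg Matrix.det (β.toMatrix_mul_toMatrix_flip γ)
    rw [Matrix.det_mul, Matrix.det_one] at this
    exact IsUnit.of_mul_eq_one _ this
  rcases Int.isUnit_iff.mp hu with h1 | h1 <;> rw [h1] <;> ring

/-! It suffices that `det B` is a square mod 4 and agrees with `dpf B` mod 2, since a square mod 4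
depends only on its root mod 2.

Square mod 4 (`exists_det_eq_sq`): let `v` be the first column. Tracelikeness makes the diagonal of
`B - v vᵀ` even, and its determinant is `(1 - n) det B`. For `n = 2m` the even form has determinant
`(-1)^m r²`, and `1 - 2m = (-1)^m` mod 4.

Parity (`intCast_det_eq_intCast_dpf`): mod 2 the Leibniz sum reduces to involutions, and `dpf` is
the sum over those fixing the first index. Involutions moving that index are traded for ones fixing
it; each of the latter is then counted an odd number of times.

For rings, the diagonal condition is Frobenius for traces over `𝔽₂`. -/

/-! ### Determinants of symmetric matrices over ℤ/4. -/

/-- A Stickelberger congruence for even symmetric forms: the determinant of a symmetric matrix of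
size `2m` over `ℤ/4` with even diagonal is `(-1)^m` times a square. -/
theorem exists_det_eq_neg_one_pow_mul_sq (m : ℕ) : ∀ {ι : Type} [Fintype ι] [DecidableEq ι]
    (S : Matrix ι ι (ZMod 4)), Fintype.card ι = 2 * m → S.IsSymm → (∀ i, 2 * S i i = 0) →
    ∃ r : ZMod 4, S.det = (-1) ^ m * r ^ 2 := by
  induction m with
  | zero =>
    intro ι _ _ S hc _ _
    have : IsEmpty ι := Fintype.card_eq_zero_iff.mp (by simpa using hc)
    exact ⟨1, by simp⟩
  | succ m ih =>
    intro ι _ _ S hc hS hd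
    -- An odd entry, necessarily off the diagonal, gives an invertible 2 × 2 block to split off by a
    -- Schur complement.
    by_cases hodd : ∃ i j, 2 * S i j ≠ 0
    · obtain ⟨i, j, hij⟩ := hodd
      have hne : i ≠ j := by
        rintro rfl
        exact hij (hd i)
      have hinj : Function.Injective ![i, j] := by
        intro a b hab
        fin_cases a <;> fin_cases b <;> simp_all [eq_comm]
      let e : Fin 2 ⊕ ↥(Set.range ![i, j])ᶜ ≃ ι :=
        ((Equiv.ofInjective _ hinj).sumCongr (Equiv.refl _)).trans
          (Equiv.Set.sumCompl (Set.range ![i, j]))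
      have hcard : Fintype.card ↥(Set.range ![i, j])ᶜ = 2 * m := by
        have := Fintype.card_congr e
        rw [Fintype.card_sum, Fintype.card_fin] at this
        omega
      obtain ⟨T, hT⟩ : ∃ T, T = S.submatrix e e := ⟨_, rfl⟩
      have hTS : T.IsSymm := hT ▸ hS.submatrix e
      have hTd : ∀ k, 2 * T k k = 0 := fun k => hT ▸ hd (e k)
      have hdet : S.det = T.det := hT ▸ (Matrix.det_submatrix_equiv_self e S).symm
      have hb : 2 * T (.inl 0) (.inl 1) ≠ 0 := hT ▸ hij
      have hs : T (.inl 1) (.inl 0) = T (.inl 0) (.inl 1) := hTS.apply _ _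
      have h0 := hTd (.inl 0)
      have h1 := hTd (.inl 1)
      generalize hea : T (.inl 0) (.inl 0) = a at *
      generalize heb : T (.inl 0) (.inl 1) = b at *
      generalize hec : T (.inl 1) (.inl 1) = c at *
      have hA : T.toBlocks₁₁ = !![a, b; b, c] := by
        ext x y
        fin_cases x <;> fin_cases y <;> simp [Matrix.toBlocks₁₁, hea, heb, hec, hs]
      -- Here `a`, `c` are even and `b` is odd; this block supplies one factor `-1`.
      have hdetA : a * c - b ^ 2 = -1 := by
        clear * - h0 h1 hb
        revert a b c
        decide
      let N : Matrix (Fin 2) (Fin 2) (ZMod 4) := !![-c, b; b, -a]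
      have hNA : N * T.toBlocks₁₁ = 1 := by
        rw [hA]
        ext x y
        fin_cases x <;> fin_cases y <;> simp [N, Matrix.mul_apply, Fin.sum_univ_two] <;>
          first | ring1 | linear_combination -hdetA
      let : Invertible T.toBlocks₁₁ := ⟨N, hNA, mul_eq_one_comm.mp hNA⟩
      have hinv : ⅟T.toBlocks₁₁ = N := rfl
      have h21 : T.toBlocks₂₁ = T.toBlocks₁₂.transpose := by
        ext x y
        exact hTS.apply _ _
      have hfin := Matrix.det_fromBlocks₁₁ T.toBlocks₁₁ T.toBlocks₁₂ T.toBlocks₂₁ T.toBlocks₂₂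
      rw [Matrix.fromBlocks_toBlocks, hinv, h21, hA, Matrix.det_fin_two_of] at hfin
      obtain ⟨r, hr⟩ := ih (T.toBlocks₂₂ - T.toBlocks₁₂.transpose * N * T.toBlocks₁₂) hcard
        (by
          have hN : N.transpose = N := by
            ext x y
            fin_cases x <;> fin_cases y <;> simp [N]
          have hD : T.toBlocks₂₂.transpose = T.toBlocks₂₂ := by
            ext x y
            exact hTS.apply _ _
          simp [Matrix.IsSymm, Matrix.transpose_mul, hN, hD, Matrix.mul_assoc])
        (by
          intro k
          have h4 : (4 : ZMod 4) = 0 := rfl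
          have hk := hTd (.inr k)
          simp only [Matrix.sub_apply, Matrix.mul_apply, Fin.sum_univ_two, Matrix.transpose_apply,
            N, Matrix.toBlocks₂₂, Matrix.toBlocks₁₂, Matrix.of_apply, Matrix.cons_val_zero,
            Matrix.cons_val_one]
          linear_combination hk + T (.inl 0) (.inr k) ^ 2 * h1 + T (.inl 1) (.inr k) ^ 2 * h0
            - b * T (.inl 0) (.inr k) * T (.inl 1) (.inr k) * h4)
      refine ⟨r, ?_⟩
      rw [hdet, hfin, hr, pow_succ]
      linear_combination ((-1) ^ m * r ^ 2) * hdetA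
    -- All entries are even and the size is at least 2, so the determinant vanishes mod 4.
    · push Not at hodd
      refine ⟨0, ?_⟩
      have hhalf : ∀ x : ZMod 4, 2 * x = 0 → ∃ y, x = 2 * y := by decide
      choose M hM using fun i j => hhalf _ (hodd i j)
      have hSM : S = (2 : ZMod 4) • Matrix.of M := by
        ext i j
        simpa using hM i j
      rw [hSM, Matrix.det_smul, hc, Nat.mul_succ, pow_add, show (2 : ZMod 4) ^ 2 = 0 from rfl]
      simp

/-- The vector `x` is characteristic up to parity: subtracting the rank-one form of `B x` makes the
diagonal even and scales the determinant by the sign `(-1)^m`. -/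
theorem exists_det_eq_sq_of_even {ι : Type} [Fintype ι] [DecidableEq ι]
    (B : Matrix ι ι (ZMod 4)) (x : ι → ZMod 4) (hB : B.IsSymm) (hcard : Even (Fintype.card ι))
    (hx : x ⬝ᵥ B.mulVec x = Fintype.card ι) (hd : ∀ i, 2 * (B i i - B.mulVec x i ^ 2) = 0) :
    ∃ r : ZMod 4, B.det = r ^ 2 := by
  obtain ⟨m, hm⟩ := hcard
  set v := B.mulVec x with hv
  have hvx : Matrix.vecMul x B = v := by
    rw [hv, ← Matrix.vecMul_transpose, hB.eq]
  have hC : B - Matrix.vecMulVec v v = B * (1 - Matrix.vecMulVec x v) := by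
    rw [mul_sub, mul_one, Matrix.mul_vecMulVec]
  have hdet : (1 - Matrix.vecMulVec x v).det = (-1) ^ m := by
    rw [Matrix.vecMulVec_eq Unit, Matrix.det_one_sub_mul_comm, Matrix.det_unique]
    simp only [Matrix.sub_apply, Matrix.one_apply_eq, Matrix.replicateRow_mul_replicateCol_apply]
    rw [dotProduct_comm, hx, hm]
    have h4 : (4 : ZMod 4) = 0 := rfl
    rcases Nat.even_or_odd' m with ⟨k, rfl | rfl⟩
    · rw [pow_mul]
      push_cast
      linear_combination (-k : ZMod 4) * h4
    · rw [pow_succ, pow_mul]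
      push_cast
      linear_combination (-k : ZMod 4) * h4
  obtain ⟨r, hr⟩ := exists_det_eq_neg_one_pow_mul_sq m (B - Matrix.vecMulVec v v)
    (by omega)
    (by
      ext i j
      simp [Matrix.vecMulVec_apply, hB.apply i j, mul_comm])
    (by
      intro i
      rw [← hd i, Matrix.sub_apply, Matrix.vecMulVec_apply, sq])
  rw [hC, Matrix.det_mul, hdet] at hr
  refine ⟨r, ?_⟩
  have hsq : ((-1 : ZMod 4) ^ m) * (-1) ^ m = 1 := by
    rw [← mul_pow]
    simp
  linear_combination (-1) ^ m * hr - (B.det - r ^ 2) * hsq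

theorem exists_det_eq_sq {ι : Type} [Fintype ι] [DecidableEq ι]
    (B : Matrix ι ι (ZMod 4)) (x : ι → ZMod 4) (hB : B.IsSymm)
    (hx : x ⬝ᵥ B.mulVec x = Fintype.card ι) (hd : ∀ i, 2 * (B i i - B.mulVec x i ^ 2) = 0) :
    ∃ r : ZMod 4, B.det = r ^ 2 := by
  rcases Nat.even_or_odd (Fintype.card ι) with h | h
  · exact exists_det_eq_sq_of_even B x hB h hx hd
  -- An orthogonal summand `⟨1⟩` makes the size even, keeps the determinant and raises the norm of
  -- `x` by 1.
  · obtain ⟨r, hr⟩ := exists_det_eq_sq_of_even (ι := ι ⊕ Unit)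
      (Matrix.fromBlocks B 0 0 1) (Sum.elim x 1)
      (hB.fromBlocks (by simp) Matrix.isSymm_one) (by simpa using h.add_one)
      (by simp [Matrix.fromBlocks_mulVec, hx])
      (by
        rintro (i | i)
        · simpa [Matrix.fromBlocks_mulVec] using hd i
        · simp [Matrix.fromBlocks_mulVec])
    exact ⟨r, by simpa using hr⟩

/-! ### Perfect matchings and involutions. -/

/-- An involution is determined by its cycles: every perfect matching on `J` is the set of orbits of
a unique involution with support `J`. -/
theorem exists_perm_of_mem_perfectMatchings {n : ℕ} {J : Finset (Fin n)} {P : Finpartition J}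
    (hP : P ∈ perfectMatchings J) :
    ∃ τ : Equiv.Perm (Fin n), τ * τ = 1 ∧ τ.support = J ∧
      P.parts = J.image fun x => {x, τ x} := by
  have hcard : ∀ s ∈ P.parts, s.card = 2 := (Finset.mem_filter.mp hP).2
  have hpart : ∀ x ∈ J, ∃ y, y ≠ x ∧ P.part x = {x, y} := by
    intro x hx
    obtain ⟨a, b, hab, h⟩ := Finset.card_eq_two.mp (hcard _ (P.part_mem.mpr hx))
    have hmem : x ∈ P.part x := P.mem_part_self.mpr hx
    rw [h, Finset.mem_insert, Finset.mem_singleton] at hmem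
    rcases hmem with rfl | rfl
    · exact ⟨b, hab.symm, h⟩
    · exact ⟨a, hab, h.trans (Finset.pair_comm _ _)⟩
  choose f hne hf using hpart
  have hfJ : ∀ x (hx : x ∈ J), f x hx ∈ J := fun x hx =>
    P.part_subset x (by simp [hf x hx])
  have hff : ∀ x (hx : x ∈ J), f (f x hx) (hfJ x hx) = x := by
    intro x hx
    have h1 : P.part (f x hx) = P.part x :=
      P.part_eq_of_mem (P.part_mem.mpr hx) (by simp [hf x hx])
    have h2 : f (f x hx) (hfJ x hx) ∈ P.part x := by
      rw [← h1, hf _ (hfJ x hx)]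
      simp
    rw [hf x hx, Finset.mem_insert, Finset.mem_singleton] at h2
    exact h2.resolve_right (hne _ (hfJ x hx))
  let g : Fin n → Fin n := fun x => if hx : x ∈ J then f x hx else x
  have hg : Function.Involutive g := by
    intro x
    by_cases hx : x ∈ J
    · simp [g, hx, hfJ x hx, hff x hx]
    · simp [g, hx]
  refine ⟨hg.toPerm g, ?_, ?_, ?_⟩
  · ext x
    simp [hg x]
  · ext x
    by_cases hx : x ∈ J <;> simp [g, hx, hne]
  · ext s
    simp only [Finset.mem_image, Function.Involutive.coe_toPerm]
    constructor
    · intro hs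
      obtain ⟨x, hx⟩ := P.nonempty_of_mem_parts hs
      have hxJ := P.subset hs hx
      exact ⟨x, hxJ, by rw [← P.part_eq_of_mem hs hx, hf x hxJ]; simp [g, hxJ]⟩
    · rintro ⟨x, hx, rfl⟩
      have := P.part_mem.mpr hx
      rw [hf x hx] at this
      simpa [g, hx] using this

theorem perm_apply_apply_of_mul_self {α : Type*} {τ : Equiv.Perm α} (hτ : τ * τ = 1) (x : α) :
    τ (τ x) = x := by
  simpa using congrArg (fun σ : Equiv.Perm α => σ x) hτ

theorem perm_pair_eq_of_mem {α : Type*} [DecidableEq α] {τ : Equiv.Perm α} (hτ : τ * τ = 1)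
    {x y : α} (h : y ∈ ({x, τ x} : Finset α)) : ({x, τ x} : Finset α) = {y, τ y} := by
  rw [Finset.mem_insert, Finset.mem_singleton] at h
  rcases h with rfl | rfl
  · rfl
  · rw [perm_apply_apply_of_mul_self hτ, Finset.pair_comm]

theorem exists_perfectMatching_of_perm {n : ℕ} {τ : Equiv.Perm (Fin n)} (hτ : τ * τ = 1) :
    ∃ P ∈ perfectMatchings τ.support, P.parts = τ.support.image fun x => {x, τ x} := by
  refine ⟨Finpartition.ofExistsUnique (τ.support.image fun x => {x, τ x}) ?_ ?_ ?_, ?_, rfl⟩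
  · intro s hs
    obtain ⟨x, hx, rfl⟩ := Finset.mem_image.mp hs
    rw [Finset.insert_subset_iff, Finset.singleton_subset_iff]
    exact ⟨hx, Equiv.Perm.apply_mem_support.mpr hx⟩
  · intro x hx
    refine ⟨{x, τ x}, ⟨Finset.mem_image_of_mem _ hx, by simp⟩, ?_⟩
    rintro s ⟨hs, hxs⟩
    obtain ⟨y, hy, rfl⟩ := Finset.mem_image.mp hs
    exact perm_pair_eq_of_mem hτ hxs
  · intro h
    obtain ⟨x, -, hx⟩ := Finset.mem_image.mp h
    exact Finset.insert_ne_empty _ _ hx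
  · refine Finset.mem_filter.mpr ⟨Finset.mem_univ _, ?_⟩
    intro s hs
    obtain ⟨x, hx, rfl⟩ := Finset.mem_image.mp hs
    exact Finset.card_pair (Equiv.Perm.mem_support.mp hx).symm

/-- Each 2-cycle contributes its entry twice on the right, and squaring is the identity on ℤ/2. -/
theorem prod_parts_eq_prod_support {n : ℕ} [NeZero n] {B : Matrix (Fin n) (Fin n) ℤ}
    (hB : B.IsSymm) {τ : Equiv.Perm (Fin n)} (hτ : τ * τ = 1) :
    ((∏ s ∈ τ.support.image fun x => ({x, τ x} : Finset (Fin n)), pairEntry B s : ℤ) : ZMod 2) =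
      ∏ x ∈ τ.support, (B (τ x) x : ZMod 2) := by
  rw [← Finset.prod_fiberwise_of_maps_to
    (fun x hx => Finset.mem_image_of_mem (fun x => ({x, τ x} : Finset (Fin n))) hx)]
  push_cast
  refine Finset.prod_congr rfl fun s hs => ?_
  obtain ⟨x, hx, rfl⟩ := Finset.mem_image.mp hs
  have hfib : τ.support.filter (fun y => ({y, τ y} : Finset (Fin n)) = {x, τ x}) = {x, τ x} := by
    ext y
    rw [Finset.mem_filter]
    constructor
    · rintro ⟨-, h⟩
      rw [← h]
      simp
    · intro h
      refine ⟨?_, (perm_pair_eq_of_mem hτ h).symm⟩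
      rw [Finset.mem_insert, Finset.mem_singleton] at h
      rcases h with rfl | rfl
      · exact hx
      · exact Equiv.Perm.apply_mem_support.mpr hx
  rw [hfib, Finset.prod_pair (Equiv.Perm.mem_support.mp hx).symm,
    perm_apply_apply_of_mul_self hτ, pairEntry_pair hB, hB.apply x (τ x), ← sq, ZMod.pow_card]

/-- Modulo `2` the discriminant pfaffian is a sum over the involutions fixing the first index. -/
theorem intCast_dpf {n : ℕ} [NeZero n] {B : Matrix (Fin n) (Fin n) ℤ} (hB : IsTracelike B) :
    (dpf B : ZMod 2) =
      ∑ τ : Equiv.Perm (Fin n) with τ * τ = 1 ∧ τ 0 = 0,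
        ∏ i ∈ Finset.univ.erase 0, (B (τ i) i : ZMod 2) := by
  classical
  have hex : ∀ (J : Finset (Fin n)) (P : Finpartition J), ∃ τ : Equiv.Perm (Fin n),
      P ∈ perfectMatchings J → τ * τ = 1 ∧ τ.support = J ∧
        P.parts = J.image fun x => {x, τ x} := fun J P => by
    by_cases hP : P ∈ perfectMatchings J
    · obtain ⟨τ, h⟩ := exists_perm_of_mem_perfectMatchings hP
      exact ⟨τ, fun _ => h⟩
    · exact ⟨1, fun h => absurd h hP⟩
  choose F hF using hex
  rw [dpf, Finset.sum_sigma']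
  push_cast
  refine Finset.sum_bij (fun q _ => F q.1 q.2) ?_ ?_ ?_ ?_
  · rintro ⟨J, P⟩ h
    simp only [Finset.mem_sigma, Finset.mem_filter, Finset.mem_powerset] at h
    obtain ⟨h1, h2, h3⟩ := hF J P h.2
    simp only [Finset.mem_filter, Finset.mem_univ, true_and]
    refine ⟨h1, ?_⟩
    rw [← Equiv.Perm.notMem_support, h2]
    exact fun h0 => by simpa using h.1.1 h0
  · rintro ⟨J, P⟩ h ⟨J', P'⟩ h' heq
    simp only [Finset.mem_sigma] at h h'
    obtain ⟨-, h2, h3⟩ := hF J P h.2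
    obtain ⟨-, h2', h3'⟩ := hF J' P' h'.2
    simp only at heq
    obtain rfl : J = J' := by rw [← h2, ← h2', heq]
    obtain rfl : P = P' := Finpartition.ext (by rw [h3, h3', heq])
    rfl
  · intro τ hτ
    simp only [Finset.mem_filter, Finset.mem_univ, true_and] at hτ
    obtain ⟨P, hP, hparts⟩ := exists_perfectMatching_of_perm hτ.1
    refine ⟨⟨τ.support, P⟩, ?_, ?_⟩
    · simp only [Finset.mem_sigma, Finset.mem_filter, Finset.mem_powerset]
      refine ⟨⟨fun x hx => ?_, ?_⟩, hP⟩
      · rw [Finset.mem_erase]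
        refine ⟨?_, Finset.mem_univ _⟩
        rintro rfl
        exact Equiv.Perm.mem_support.mp hx hτ.2
      · exact even_iff_two_dvd.mpr (Equiv.Perm.two_dvd_card_support (by rw [sq, hτ.1]))
    · obtain ⟨h1, h2, h3⟩ := hF _ _ hP
      simp only
      set σ := F τ.support P
      ext x
      congr 1
      by_cases hx : x ∈ τ.support
      · have hxσ : x ∈ σ.support := h2 ▸ hx
        have hmem : ({x, σ x} : Finset (Fin n)) ∈ τ.support.image fun x => {x, τ x} := by
          rw [← hparts, h3]
          exact Finset.mem_image_of_mem (fun x => ({x, σ x} : Finset (Fin n))) hx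
        obtain ⟨y, -, hy⟩ := Finset.mem_image.mp hmem
        have hxy : ({x, σ x} : Finset (Fin n)) = {x, τ x} :=
          hy.symm.trans (perm_pair_eq_of_mem hτ.1 (by rw [hy]; simp))
        have : σ x ∈ ({x, τ x} : Finset (Fin n)) := by
          rw [← hxy]
          simp
        rw [Finset.mem_insert, Finset.mem_singleton] at this
        exact this.resolve_left (Equiv.Perm.mem_support.mp hxσ)
      · rw [Equiv.Perm.notMem_support.mp hx, Equiv.Perm.notMem_support.mp (h2.symm ▸ hx)]
  · rintro ⟨J, P⟩ h
    simp only [Finset.mem_sigma, Finset.mem_filter, Finset.mem_powerset] at h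
    obtain ⟨h1, h2, h3⟩ := hF J P h.2
    simp only
    generalize F J P = τ at *
    subst h2
    have hsub : τ.support ⊆ Finset.univ.erase 0 := h.1.1
    rw [h3, ← Finset.prod_sdiff hsub, mul_comm]
    congr 1
    · refine Finset.prod_congr rfl fun k hk => ?_
      rw [Finset.mem_sdiff, Finset.mem_erase, Equiv.Perm.notMem_support] at hk
      have hdiag := (ZMod.intCast_eq_intCast_iff _ _ _).mpr (hB.diag k hk.1.1)
      push_cast at hdiag
      rw [hk.2, hdiag, ZMod.pow_card]
    · rw [← prod_parts_eq_prod_support hB.isSymm h1]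
      push_cast
      rfl

/-! ### The determinant modulo 2. -/

/-- By symmetry `σ` and `σ⁻¹` give equal terms, which cancel in pairs. -/
theorem intCast_det_eq_sum_involutions {n : ℕ} {M : Matrix (Fin n) (Fin n) (ZMod 2)}
    (hM : M.IsSymm) :
    M.det = ∑ σ : Equiv.Perm (Fin n) with σ * σ = 1, ∏ i, M (σ i) i := by
  have hsign : M.det = ∑ σ : Equiv.Perm (Fin n), ∏ i, M (σ i) i := by
    rw [Matrix.det_apply]
    refine Finset.sum_congr rfl fun σ _ => ?_
    rcases Int.units_eq_one_or (Equiv.Perm.sign σ) with h | h <;> simp [h]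
  rw [hsign, ← Finset.sum_filter_add_sum_filter_not _ fun σ : Equiv.Perm (Fin n) => σ * σ = 1]
  refine add_eq_left.mpr (Finset.sum_involution (fun σ _ => σ⁻¹) ?_ ?_ ?_ ?_)
  · intro σ _
    have : ∏ i, M (σ⁻¹ i) i = ∏ i, M (σ i) i := by
      rw [← Equiv.prod_comp σ]
      refine Finset.prod_congr rfl fun i _ => ?_
      rw [Equiv.Perm.inv_def, Equiv.symm_apply_apply, hM.apply]
    rw [this, CharTwo.add_self_eq_zero]
  · intro σ hσ _ h
    refine (Finset.mem_filter.mp hσ).2 ?_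
    nth_rewrite 1 [← h]
    simp
  · intro σ hσ
    simp only [Finset.mem_filter, Finset.mem_univ, true_and] at hσ ⊢
    rwa [← mul_inv_rev, inv_eq_one]
  · intro σ _
    simp

/-- Multiplication by the transposition `(0 k)` relates the involutions mapping `0` to `k` with those
fixing both `0` and `k`, and the corresponding products of entries. -/
theorem sum_involutions_apply_zero_eq {n : ℕ} [NeZero n] {M : Matrix (Fin n) (Fin n) (ZMod 2)}
    (hM : M.IsSymm) (hd : ∀ i, i ≠ 0 → M i i = M 0 i) {k : Fin n} (hk : k ≠ 0) :
    ∑ σ : Equiv.Perm (Fin n) with σ * σ = 1 ∧ σ 0 = k, ∏ i, M (σ i) i =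
      ∑ τ : Equiv.Perm (Fin n) with (τ * τ = 1 ∧ τ 0 = 0) ∧ τ k = k,
        ∏ i ∈ Finset.univ.erase 0, M (τ i) i := by
  have hcomm : ∀ σ : Equiv.Perm (Fin n), σ * σ = 1 → ∀ a b,
      (Equiv.swap a b * σ) * (Equiv.swap a b * σ) =
        Equiv.swap a b * Equiv.swap (σ a) (σ b) := by
    intro σ hσ a b
    have hinv : σ⁻¹ = σ := inv_eq_of_mul_eq_one_left hσ
    rw [Equiv.swap_apply_apply, hinv]
    group
  refine Finset.sum_bij' (fun σ _ => Equiv.swap 0 k * σ) (fun τ _ => Equiv.swap 0 k * τ)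
    ?_ ?_ ?_ ?_ ?_
  · intro σ h
    simp only [Finset.mem_filter, Finset.mem_univ, true_and] at h ⊢
    have hσk : σ k = 0 := by rw [← h.2, perm_apply_apply_of_mul_self h.1]
    refine ⟨⟨?_, ?_⟩, ?_⟩
    · rw [hcomm σ h.1, h.2, hσk, Equiv.swap_comm k 0, Equiv.swap_mul_self]
    · simp [h.2]
    · simp [hσk]
  · intro τ h
    simp only [Finset.mem_filter, Finset.mem_univ, true_and] at h ⊢
    refine ⟨?_, ?_⟩
    · rw [hcomm τ h.1.1, h.1.2, h.2, Equiv.swap_mul_self]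
    · simp [h.1.2]
  · intro σ _
    simp
  · intro τ _
    simp
  · intro σ h
    simp only [Finset.mem_filter, Finset.mem_univ, true_and] at h
    have hσk : σ k = 0 := by rw [← h.2, perm_apply_apply_of_mul_self h.1]
    have hk' : k ∈ (Finset.univ : Finset (Fin n)).erase 0 :=
      Finset.mem_erase.mpr ⟨hk, Finset.mem_univ _⟩
    -- The two factors at `0` and `k` multiply to `M 0 k ^ 2 = M 0 k = M k k`, the factor of the
    -- fixed point `k`.
    rw [← Finset.mul_prod_erase _ _ (Finset.mem_univ 0), ← Finset.mul_prod_erase _ _ hk',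
      ← Finset.mul_prod_erase _ _ hk', h.2, hσk, ← mul_assoc, hM.apply 0 k, ← sq, ZMod.pow_card]
    congr 1
    · simp [hσk, hd k hk]
    · refine Finset.prod_congr rfl fun i hi => ?_
      simp only [Finset.mem_erase, Finset.mem_univ, and_true] at hi
      rw [Equiv.Perm.mul_apply, Equiv.swap_apply_of_ne_of_ne]
      · rw [← hσk, σ.injective.ne_iff]
        exact hi.1
      · rw [← h.2, σ.injective.ne_iff]
        exact hi.2

/-- The left side is the multiplicity of `τ`: `n` from the corner entry, plus one for each
involution traded for `τ`. It is odd because the support is even. -/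
theorem natCast_add_card_fixed_eq_one {n : ℕ} [NeZero n] {τ : Equiv.Perm (Fin n)}
    (hτ : τ * τ = 1) (h0 : τ 0 = 0) :
    (n : ZMod 2) + ((Finset.univ.erase 0).filter fun k => τ k = k).card = 1 := by
  obtain ⟨m, hm⟩ := Equiv.Perm.two_dvd_card_support (σ := τ) (by rw [sq, hτ])
  have hfix : ((Finset.univ.erase 0).filter fun k => τ k = k) = τ.supportᶜ.erase 0 := by
    ext k
    simp [and_comm]
  have hcard : (τ.supportᶜ.erase 0).card + 1 + τ.support.card = n := by
    rw [Finset.card_erase_add_one (by simp [h0]), Finset.card_compl_add_card, Fintype.card_fin]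
  rw [hfix]
  have := congrArg (Nat.cast : ℕ → ZMod 2) hcard
  rw [hm] at this
  push_cast at this
  have h2 : (2 : ZMod 2) = 0 := rfl
  linear_combination (-1 : ZMod 2) * this + ((τ.supportᶜ.erase 0).card + m : ZMod 2) * h2

theorem intCast_det_eq_intCast_dpf {n : ℕ} [NeZero n] {B : Matrix (Fin n) (Fin n) ℤ}
    (hB : IsTracelike B) : (B.det : ZMod 2) = dpf B := by
  rw [intCast_dpf hB, show (B.det : ZMod 2) = ((Int.castRingHom (ZMod 2)).mapMatrix B).det from
    (Int.castRingHom (ZMod 2)).map_det B]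
  set M : Matrix (Fin n) (Fin n) (ZMod 2) := (Int.castRingHom (ZMod 2)).mapMatrix B with hMB
  have hM : M.IsSymm := hB.isSymm.map _
  have h00 : M 0 0 = n := by simp [hMB, hB.corner]
  have hd : ∀ i, i ≠ 0 → M i i = M 0 i := by
    intro i hi
    have := (ZMod.intCast_eq_intCast_iff _ _ _).mpr (hB.diag i hi)
    push_cast at this
    rw [ZMod.pow_card] at this
    simpa [hMB] using this
  change _ = ∑ τ : Equiv.Perm (Fin n) with τ * τ = 1 ∧ τ 0 = 0,
    ∏ i ∈ Finset.univ.erase 0, M (τ i) i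
  rw [intCast_det_eq_sum_involutions hM, ← Finset.sum_fiberwise _ (fun σ => σ 0),
    ← Finset.add_sum_erase _ _ (Finset.mem_univ 0)]
  simp only [Finset.filter_filter]
  rw [Finset.sum_congr rfl fun k hk =>
    sum_involutions_apply_zero_eq hM hd (Finset.ne_of_mem_erase hk)]
  rw [Finset.sum_comm' (t' := Finset.univ.filter fun τ : Equiv.Perm (Fin n) => τ * τ = 1 ∧ τ 0 = 0)
      (s' := fun τ => (Finset.univ.erase 0).filter fun k => τ k = k)
      (fun k τ => by simp only [Finset.mem_filter, Finset.mem_univ, true_and]; tauto),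
    ← Finset.sum_add_distrib]
  refine Finset.sum_congr rfl fun τ hτ => ?_
  obtain ⟨h1, h0⟩ := (Finset.mem_filter.mp hτ).2
  rw [Finset.sum_const, nsmul_eq_mul,
    ← Finset.mul_prod_erase _ _ (Finset.mem_univ 0), h0, h00, ← add_mul,
    natCast_add_card_fixed_eq_one h1 h0, one_mul]

/-! ### Tracelike matrices and Gram matrices of rings. -/

theorem IsTracelike.exists_intCast_det_eq_sq {n : ℕ} [NeZero n] {B : Matrix (Fin n) (Fin n) ℤ}
    (hB : IsTracelike B) : ∃ r : ZMod 4, (B.det : ZMod 4) = r ^ 2 := by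
  rw [show (B.det : ZMod 4) = ((Int.castRingHom (ZMod 4)).mapMatrix B).det from
    (Int.castRingHom (ZMod 4)).map_det B]
  have hcol : ∀ i, ((Int.castRingHom (ZMod 4)).mapMatrix B).mulVec (Pi.single 0 1) i = B 0 i := by
    intro i
    simp [hB.isSymm.apply 0 i]
  refine exists_det_eq_sq _ (Pi.single 0 1) (hB.isSymm.map _) ?_ fun i => ?_
  · rw [single_dotProduct, hcol, hB.corner]
    simp
  · rw [hcol]
    have hdiag : B i i ≡ B 0 i ^ 2 [ZMOD 2] := by
      by_cases hi : i = 0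
      · subst hi
        -- At the corner the congruence is automatic, as `b² - b` is even.
        rw [Int.modEq_iff_dvd, sq, ← mul_sub_one]
        exact (Int.even_mul_pred_self _).two_dvd
      · exact hB.diag i hi
    obtain ⟨c, hc⟩ := (Int.modEq_iff_dvd.mp hdiag.symm)
    have hc' := congrArg (Int.cast : ℤ → ZMod 4) hc
    push_cast at hc'
    have h4 : (4 : ZMod 4) = 0 := rfl
    simp only [RingHom.mapMatrix_apply, Matrix.map_apply, Int.coe_castRingHom]
    linear_combination 2 * hc' + c * h4

theorem Int.modEq_four_sq_of_intCast {a d : ℤ} (ha : ∃ r : ZMod 4, (a : ZMod 4) = r ^ 2)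
    (had : (a : ZMod 2) = d) : a ≡ d ^ 2 [ZMOD 4] := by
  have key : ∀ x y r : ZMod 4, x = r ^ 2 → 2 * (y - x) = 0 → x = y ^ 2 := by decide
  obtain ⟨r, hr⟩ := ha
  rw [ZMod.intCast_eq_intCast_iff] at had
  obtain ⟨c, hc⟩ := Int.modEq_iff_dvd.mp had
  have hc' := congrArg (Int.cast : ℤ → ZMod 4) hc
  push_cast at hc'
  have h4 : (4 : ZMod 4) = 0 := rfl
  refine (ZMod.intCast_eq_intCast_iff _ _ 4).mp ?_
  push_cast
  exact key _ _ r hr (by linear_combination 2 * hc' + c * h4)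

theorem IsTracelike.det_modEq_dpf_sq {n : ℕ} [NeZero n] {B : Matrix (Fin n) (Fin n) ℤ}
    (hB : IsTracelike B) : B.det ≡ dpf B ^ 2 [ZMOD 4] :=
  Int.modEq_four_sq_of_intCast hB.exists_intCast_det_eq_sq (intCast_det_eq_intCast_dpf hB)

theorem isTracelike_gramMatrix {A : Type*} [Ring A] {n : ℕ} [NeZero n]
    (β : Module.Basis (Fin n) ℤ A) (hβ : β 0 = 1) : IsTracelike (gramMatrix β) where
  isSymm := gramMatrix_isSymm β
  corner := by simp [gramMatrix, hβ]
  diag i _ := by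
    refine (ZMod.intCast_eq_intCast_iff _ _ 2).mp ?_
    -- Over `𝔽₂`, `tr(M²) = tr(M)²`.
    have h := ZMod.trace_pow_card
      ((Int.castRingHom (ZMod 2)).mapMatrix (Algebra.leftMulMatrix β (β i)))
    rw [← map_pow, ← map_pow] at h
    simp only [RingHom.mapMatrix_apply, ← AddMonoidHom.map_trace] at h
    simpa [gramMatrix, hβ, ← sq] using h

theorem theorem4p2 :
    (∀ (n : ℕ) [NeZero n] (B : Matrix (Fin n) (Fin n) ℤ), IsTracelike B →
      B.det ≡ dpf B ^ 2 [ZMOD 4]) ∧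
    (∀ (n : ℕ) [NeZero n] (A : Type*) [Ring A] [Module.Free ℤ A] [Module.Finite ℤ A]
      (β : Module.Basis (Fin n) ℤ A), β 0 = 1 →
      disc A ≡ ringDpf β ^ 2 [ZMOD 4]) := by
  refine ⟨fun n _ B hB => hB.det_modEq_dpf_sq, fun n _ A _ _ _ β hβ => ?_⟩
  rw [disc_eq_det_gramMatrix β]
  exact (isTracelike_gramMatrix β hβ).det_modEq_dpf_sq
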